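/- Let $(X,d)$ be a nonempty complete metric space, let $m,n\ge 1$ be integers, and equip $X^m$ with the maximum metric $d^m$. Let $\phi_0,\dots,\phi_{n-1}:X^m\to X$ be continuous generalized Matkowski contractions: for each $j$ there is a nondecreasing $\varphi_j:[0,\infty)\to[0,\infty)$ whose iterates satisfy $\varphi_j^{(k)}(t)\to 0$ as $k\to\infty$ for every $t>0$, such that $d(\phi_j(x),\phi_j(y))\le\varphi_j(d^m(x,y))$ for all $x,y\in X^m$. Let $\rho_0,\dots,\rho_{n-1}:[0,1]\to[0,1]$ be a proper system of grey level maps, that is: each $\rho_j$ is not identically zero, nondecreasing and right-continuous with $\rho_j(0)=0$; $\rho_j(1)=1$ for at least one $j$; and, for every $j$, $\inf\{t:\rho_j(t)>0\}=0$ and $\inf\{t:\rho_j(t)\ge\rho_j(1)\}=1$. For $u:X\to[0,1]$ put $[u]^\alpha=\{x:u(x)\ge\alpha\}$ for $\alpha\in(0,1]$ and $[u]^0=\overline{\{x:u(x)>0\}}$. Let $\mathcal F_X^*$ be the set of all upper semicontinuous $u:X\to[0,1]$ that attain the value $1$ and have $[u]^0$ compact. Put $$\mathcal Z(u)(z)=\max_{0\le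 j<n}\rho_j\Big(\sup_{\phi_j(x_0,\dots,x_{m-1})=z}\ \min_{0\le i<m}u(x_i)\Big),$$ where the supremum over the empty set is $0$. Then there is a unique $u_{\mathcal Z}\in\mathcal F_X^*$ with $\mathcal Z(u_{\mathcal Z})=u_{\mathcal Z}$ (the attractor of the generalized iterated fuzzy function system $(X,(\phi_j),(\rho_j))$). For each of the systems $\mathcal S=(X,(\phi_j)_{0\le j<n})$ and $\mathcal S'=(X,(\phi_j)_{j\in I})$, where $I=\{j:\rho_j(1)=1\}$, there is a unique nonempty compact set (its attractor), denoted $A_{\mathcal S}$ and $A_{\mathcal S'}$ respectively, with $$A_{\mathcal S}=\bigcup_{0\le j<n}\phi_j(A_{\mathcal S}^m),\qquad A_{\mathcal S'}=\bigcup_{j\in I}\phi_j(A_{\mathcal S'}^m).$$ Moreover, $$[u_{\mathcal Z}]^0=A_{\mathcal S}\qquad\text{and}\qquad [u_{\mathcal Z}]^1=A_{\mathcal S'}.$$ -/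

import Mathlib

open Set Filter Topology
open scoped NNReal unitInterval

/-- Fuzzy subsets of `X`: functions from `X` to the unit interval `I = [0, 1]`. -/
abbrev FuzzySet (X : Type*) := X → I

namespace FuzzySet

/-- The grey level `[u]^α`: for `α > 0` it is the superlevel set of `u`,
for `α = 0` it is the closed support of `u`. -/
def cut {X : Type*} [TopologicalSpace X] (u : FuzzySet X) (α : I) : Set X :=
  {x | 0 < α ∧ α ≤ u x} ∪ {x | α = 0 ∧ x ∈ closure {y | 0 < u y}}

theorem cut_of_pos {X : Type*} [TopologicalSpace X] (u : FuzzySet X) {α : I} (h : 0 < α) :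
    u.cut α = {x | α ≤ u x} := by
  ext x; simp [cut, h, h.ne']

theorem cut_zero {X : Type*} [TopologicalSpace X] (u : FuzzySet X) :
    u.cut 0 = closure {x | 0 < u x} := by
  ext x; simp [cut]

/-- Membership in the family `F*_X` of normal, upper semicontinuous and compactly
supported fuzzy subsets of `X`. -/
structure IsStar {X : Type*} [TopologicalSpace X] (u : FuzzySet X) : Prop where
  normal : ∃ x, u x = 1
  usc : UpperSemicontinuous u
  compact_support : IsCompact (u.cut 0)

/-- Zadeh's extension principle: `T(u)(y)` is the supremum of `u` over the fibre of `y`. The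
supremum is taken in `I`, so it is `0` when the fibre is empty. -/
noncomputable def image {X Y : Type*} (T : X → Y) (u : FuzzySet X) : FuzzySet Y :=
  fun y => sSup (u '' (T ⁻¹' {y}))

theorem image_eq_zero {X Y : Type*} (T : X → Y) (u : FuzzySet X) {y : Y}
    (hy : y ∉ range T) : image T u y = 0 := by
  have h : T ⁻¹' {y} = ∅ := by
    ext x
    simp only [mem_preimage, mem_singleton_iff, mem_empty_iff_false, iff_false]
    exact fun h => hy ⟨x, h⟩
  simp only [image, h, image_empty, sSup_empty]
  rfl

/-- The Cartesian product of the fuzzy sets `u 0, …, u (m - 1)`. -/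
noncomputable def prod {X : Type*} {m : ℕ} (u : Fin m → FuzzySet X) : FuzzySet (Fin m → X) :=
  fun x => ⨅ i, u i (x i)

end FuzzySet

/-- A system of grey level maps (nonzero functions `[0,1] → [0,1]`) is admissible. -/
structure IsAdmissible {ι : Type*} (ρ : ι → I → I) : Prop where
  nonzero : ∀ j, ∃ t, ρ j t ≠ 0
  monotone : ∀ j, Monotone (ρ j)
  right_continuous : ∀ j t, ContinuousWithinAt (ρ j) (Ici t) t
  map_zero : ∀ j, ρ j 0 = 0
  exists_map_one : ∃ j, ρ j 1 = 1

/-- `r⁺ = inf {t | ρ t > 0}`, the infimum being taken in `[0, 1]`. -/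
noncomputable def greyThreshold (ρ : I → I) : I := sInf {t | 0 < ρ t}

/-- `β(α) = inf {t | ρ t ≥ α}`, of interest for `α ∈ [0, ρ 1]`. -/
noncomputable def greyBeta (ρ : I → I) (α : I) : I := sInf {t | α ≤ ρ t}

/-- A system of grey level maps is proper: admissible, with `r⁺_j = 0` and
`β_j(ρ_j(1)) = 1` for all `j`. -/
structure IsProperSystem {ι : Type*} (ρ : ι → I → I) : Prop where
  admissible : IsAdmissible ρ
  threshold_eq_zero : ∀ j, greyThreshold (ρ j) = 0
  beta_eq_one : ∀ j, greyBeta (ρ j) (ρ j 1) = 1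

/-- `f : X^m → X` is a generalized Matkowski contraction of degree `m`. The distance on
`Fin m → X` is the maximum distance. -/
def IsMatkowskiContraction {X : Type*} [MetricSpace X] {m : ℕ} (f : (Fin m → X) → X) : Prop :=
  ∃ φ : ℝ≥0 → ℝ≥0, Monotone φ ∧ (∀ t, 0 < t → Tendsto (fun k : ℕ => φ^[k] t) atTop (𝓝 0)) ∧
    ∀ x y, nndist (f x) (f y) ≤ φ (nndist x y)

/-- A generalized iterated function system of degree `m` on `X`, with maps indexed by the
finite type `ι`. -/
structure GIFS (X : Type*) [MetricSpace X] (m : ℕ) (ι : Type*) [Finite ι] where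
  map : ι → (Fin m → X) → X
  continuous_map : ∀ j, Continuous (map j)

namespace GIFS

variable {X : Type*} [MetricSpace X] {m : ℕ} {ι : Type*} [Finite ι]

def IsMatkowskiContractive (S : GIFS X m ι) : Prop :=
  ∀ j, IsMatkowskiContraction (S.map j)

/-- The generalized Hutchinson-Barnsley operator
`(K_0, …, K_{m-1}) ↦ ⋃ j, φ_j (K_0 × ⋯ × K_{m-1})`. -/
def operator (S : GIFS X m ι) (K : Fin m → Set X) : Set X :=
  ⋃ j, S.map j '' Set.pi univ K

/-- `A` is a nonempty compact set with `A = S(A, …, A)`. The attractor of `S` is the unique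
such set. -/
structure IsAttractor (S : GIFS X m ι) (A : Set X) : Prop where
  nonempty : A.Nonempty
  compact : IsCompact A
  fixed : S.operator (fun _ => A) = A

/-- The subsystem consisting of the maps with index in `J`. -/
def restrict (S : GIFS X m ι) (J : Set ι) : GIFS X m J where
  map j := S.map j
  continuous_map j := S.continuous_map j

end GIFS

/-- A generalized iterated fuzzy function system: a GIFS with an admissible system of grey
level maps. -/
structure GIFZS (X : Type*) [MetricSpace X] (m : ℕ) (ι : Type*) [Finite ι]
    extends GIFS X m ι where
  grey : ι → I → I
  admissible : IsAdmissible grey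

namespace GIFZS

variable {X : Type*} [MetricSpace X] {m : ℕ} {ι : Type*} [Finite ι]

/-- The generalized fuzzy Hutchinson-Barnsley operator
`(u_0, …, u_{m-1}) ↦ ⋁ j, ρ_j (φ_j (u_0 × ⋯ × u_{m-1}))`. -/
noncomputable def operator (Z : GIFZS X m ι) (u : Fin m → FuzzySet X) : FuzzySet X :=
  fun z => ⨆ j, Z.grey j (FuzzySet.image (Z.map j) (FuzzySet.prod u) z)

/-- `u ∈ F*_X` and `u = Z(u, …, u)`. The attractor of `Z` is the unique such fuzzy set. -/
structure IsFuzzyAttractor (Z : GIFZS X m ι) (u : FuzzySet X) : Prop where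
  star : u.IsStar
  fixed : Z.operator (fun _ => u) = u

end GIFZS

/-!
The two halves of the argument are a comparison principle, which gives all the uniqueness claims,
and a compact set stable under the system, inside which the fuzzy attractor is found as the least
element of a family of fuzzy sets. The attractors of the two crisp systems need not be constructed
separately: they are obtained as the cuts of the fuzzy attractor.

*One comparison function.* A monotone `φ` whose iterates tend to `0` satisfies `φ t < t` for `t > 0`
and takes some `r > s` to a value `≤ s`, for every `s > 0`. These two properties are inherited by
finite maxima and imply in turn that the iterates tend to `0`, so all the maps of the system share
one comparison function (`GIFS.IsMatkowskiContractive.exists_isComparison`).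

*Uniqueness.* Suppose that the points of `K a` are images of tuples from some `K b` under a map of
the system that takes tuples from `L b` into `L a`. If every `K a` lies within distance `t` of `L a`,
it also lies within distance `φ t`, hence `K a ⊆ closure (L a)` (`GIFS.subset_of_selfSimilar`).
Constant families give uniqueness of crisp attractors, families of cuts that of fuzzy ones.

*Cuts of the operator.* By upper semicontinuity and compactness the suprema in the definition of
`Z(u)` are attained (`GIFZS.le_operator_iff`), so `Z(u) z ≥ α > 0` means that `z` is the image under
some `φ_j` of a tuple `y` with `ρ_j (min u(y_i)) ≥ α`. With `ρ_j` positive on `(0, 1]` this shows that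
the closed support of a fixed `u` is an attractor of the whole system; as `ρ_j t = 1` only for
`t = 1`, the top cut is an attractor of the subsystem of those `j` with `ρ_j 1 = 1`.

*Existence.* The sets `E_k` obtained from a point by iterating the crisp operator move less and less,
so some `E_k` has a neighbourhood of finite radius that is stable under the system. The set
generated by the finite set `E_k` is thus at finite distance from a finite set; applying the
operator repeatedly improves this distance to `φ t`, `φ (φ t)`, …, so its closure `K` is compact
(`GIFS.exists_compact_invariant`). The pointwise infimum of all upper semicontinuous `v` supported in
`K` with `Z(v) ≤ v` and `v p = 1`, where `p` is a fixed point of `x ↦ φ_j (x, …, x)` for some `j` with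
`ρ_j 1 = 1`, is again of this kind, and so is its image under `Z`; it is therefore fixed by `Z`.
-/

/-! ### Comparison functions -/

/-- A comparison function: monotone, below the identity, and with right limit at most `s` at each
`s > 0`. For monotone `φ` this is equivalent to convergence of all iterates to `0`, in a form that
visibly passes to finite maxima. -/
structure IsComparison (φ : ℝ≥0 → ℝ≥0) : Prop where
  mono : Monotone φ
  lt_self : ∀ t, 0 < t → φ t < t
  exists_gt : ∀ s, 0 < s → ∃ r, s < r ∧ φ r ≤ s

namespace IsComparison

variable {φ : ℝ≥0 → ℝ≥0}

theorem of_tendsto (hφ : Monotone φ)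
    (h : ∀ t, 0 < t → Tendsto (fun k : ℕ => φ^[k] t) atTop (𝓝 0)) : IsComparison φ where
  mono := hφ
  lt_self t ht := by
    by_contra! hlt
    have hk : ∀ k : ℕ, t ≤ φ^[k] t := by
      intro k
      induction k with
      | zero => exact le_rfl
      | succ k ih =>
        rw [Function.iterate_succ_apply']
        exact hlt.trans (hφ ih)
    exact ht.not_ge (ge_of_tendsto' (h t ht) hk)
  exists_gt s hs := by
    by_contra! hlt
    have hk : ∀ k : ℕ, s < φ^[k] (s + 1) := by
      intro k
      induction k with
      | zero => exact lt_add_one s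
      | succ k ih =>
        rw [Function.iterate_succ_apply']
        exact hlt _ ih
    exact hs.not_ge (ge_of_tendsto' (h (s + 1) (by positivity)) fun k => (hk k).le)

theorem map_zero (hφ : IsComparison φ) : φ 0 = 0 := by
  by_contra h
  have h0 : 0 < φ 0 := pos_iff_ne_zero.2 h
  exact absurd (hφ.mono h0.le) (hφ.lt_self _ h0).not_ge

theorem le_self (hφ : IsComparison φ) (t : ℝ≥0) : φ t ≤ t := by
  rcases eq_zero_or_pos t with rfl | ht
  · exact hφ.map_zero.le
  · exact (hφ.lt_self t ht).le

theorem tendsto_iterate (hφ : IsComparison φ) (t : ℝ≥0) :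
    Tendsto (fun k : ℕ => φ^[k] t) atTop (𝓝 0) := by
  have hanti : Antitone fun k : ℕ => φ^[k] t := antitone_nat_of_succ_le fun k => by
    rw [Function.iterate_succ_apply']
    exact hφ.le_self _
  have hlim := tendsto_atTop_ciInf hanti (OrderBot.bddBelow _)
  have hle : ∀ k : ℕ, (⨅ k : ℕ, φ^[k] t) ≤ φ^[k] t := ciInf_le (OrderBot.bddBelow _)
  rcases eq_zero_or_pos (⨅ k : ℕ, φ^[k] t) with h0 | hpos
  · rwa [h0] at hlim
  · -- One step below `r` brings the iterates to at most their infimum, the next strictly below.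
    obtain ⟨r, hr, hφr⟩ := hφ.exists_gt _ hpos
    obtain ⟨k, hk⟩ := (hlim.eventually_lt_const hr).exists
    have h1 : φ (φ^[k] t) ≤ ⨅ k : ℕ, φ^[k] t := (hφ.mono hk.le).trans hφr
    have h2 := hle (k + 1)
    have h3 := hle (k + 2)
    rw [Function.iterate_succ_apply'] at h2 h3
    rw [Function.iterate_succ_apply'] at h3
    exact absurd (h3.trans_lt (hφ.lt_self _ (hpos.trans_le h2))) h1.not_gt

theorem finset_sup {ι : Type*} [Fintype ι] {φ : ι → ℝ≥0 → ℝ≥0} (h : ∀ j, IsComparison (φ j)) :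
    IsComparison fun t => Finset.univ.sup fun j => φ j t where
  mono _ _ hst := Finset.sup_mono_fun fun j _ => (h j).mono hst
  lt_self t ht := (Finset.sup_lt_iff ht).2 fun j _ => (h j).lt_self t ht
  exists_gt s hs := by
    have hev : ∀ᶠ r in 𝓝[>] s, ∀ j, φ j r ≤ s := by
      rw [eventually_all]
      intro j
      obtain ⟨r, hr, hφr⟩ := (h j).exists_gt s hs
      filter_upwards [Ioo_mem_nhdsGT hr] with q hq
      exact ((h j).mono hq.2.le).trans hφr
    obtain ⟨r, hr, hsr⟩ := (hev.and self_mem_nhdsWithin).exists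
    exact ⟨r, hsr, Finset.sup_le fun j _ => hr j⟩

end IsComparison

/-! ### Generalized iterated function systems -/

namespace GIFS

variable {X : Type*} [MetricSpace X] {m : ℕ} {ι : Type*} [Finite ι]

theorem IsMatkowskiContractive.exists_isComparison {S : GIFS X m ι}
    (hS : S.IsMatkowskiContractive) :
    ∃ φ : ℝ≥0 → ℝ≥0, IsComparison φ ∧
      ∀ j x y, nndist (S.map j x) (S.map j y) ≤ φ (nndist x y) := by
  have := Fintype.ofFinite ι
  choose φ hmono hlim hφ using hS
  refine ⟨_, IsComparison.finset_sup fun j => IsComparison.of_tendsto (hmono j) (hlim j),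
    fun j x y => (hφ j x y).trans ?_⟩
  exact Finset.le_sup (f := fun j => φ j (nndist x y)) (Finset.mem_univ j)

theorem mem_operator {S : GIFS X m ι} {K : Set X} {x : X} :
    x ∈ S.operator (fun _ => K) ↔ ∃ j y, (∀ i, y i ∈ K) ∧ S.map j y = x := by
  simp [operator]

/-- The comparison principle behind all the uniqueness statements: if `K` is built from itself by
maps of the system that respect the family `L` of closed sets, and `K` is uniformly close to `L`,
then `K ⊆ L`. -/
theorem subset_of_selfSimilar (S : GIFS X m ι) {φ : ℝ≥0 → ℝ≥0} (hφ : IsComparison φ)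
    (hS : ∀ j x y, nndist (S.map j x) (S.map j y) ≤ φ (nndist x y))
    {T : Type*} {K L : T → Set X} (hL : ∀ a, IsClosed (L a)) {B : ℝ≥0}
    (hB : ∀ a, ∀ x ∈ K a, ∃ y ∈ L a, nndist x y ≤ B)
    (h : ∀ a, ∀ x ∈ K a, ∃ j b y, S.map j y = x ∧ (∀ i, y i ∈ K b) ∧
      ∀ y', (∀ i, y' i ∈ L b) → S.map j y' ∈ L a) (a : T) : K a ⊆ L a := by
  have hk : ∀ k : ℕ, ∀ a, ∀ x ∈ K a, ∃ y ∈ L a, nndist x y ≤ φ^[k] B := by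
    intro k
    induction k with
    | zero => exact hB
    | succ k ih =>
      intro a x hx
      obtain ⟨j, b, y, rfl, hy, hL'⟩ := h a x hx
      choose y' hy' hd using fun i => ih b (y i) (hy i)
      refine ⟨S.map j y', hL' y' hy', ?_⟩
      rw [Function.iterate_succ_apply']
      exact (hS j y y').trans (hφ.mono (nndist_pi_le_iff.2 hd))
  intro x hx
  rw [← (hL a).closure_eq, Metric.mem_closure_iff]
  intro ε hε
  lift ε to ℝ≥0 using hε.le
  obtain ⟨k, hkε⟩ := ((hφ.tendsto_iterate B).eventually_lt_const (NNReal.coe_pos.1 hε)).exists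
  obtain ⟨y, hy, hd⟩ := hk k a x hx
  refine ⟨y, hy, ?_⟩
  rw [← coe_nndist]
  exact NNReal.coe_lt_coe.2 (hd.trans_lt hkε)

theorem IsAttractor.unique {S : GIFS X m ι} {φ : ℝ≥0 → ℝ≥0} (hφ : IsComparison φ)
    (hS : ∀ j x y, nndist (S.map j x) (S.map j y) ≤ φ (nndist x y)) {A A' : Set X}
    (hA : S.IsAttractor A) (hA' : S.IsAttractor A') : A = A' := by
  have key : ∀ {K L : Set X}, S.IsAttractor K → S.IsAttractor L → K ⊆ L := by
    intro K L hK hL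
    obtain ⟨p, hp⟩ := hL.nonempty
    obtain ⟨B, hB⟩ := hK.compact.isBounded.subset_closedBall p
    refine S.subset_of_selfSimilar hφ hS (T := Unit) (K := fun _ => K) (L := fun _ => L)
      (fun _ => hL.compact.isClosed) (B := B.toNNReal) (fun _ x hx => ⟨p, hp, ?_⟩)
      (fun _ x hx => ?_) ()
    · rw [← NNReal.coe_le_coe, coe_nndist]
      exact (hB hx).trans (Real.le_coe_toNNReal B)
    · rw [← hK.fixed, mem_operator] at hx
      obtain ⟨j, y, hy, rfl⟩ := hx
      exact ⟨j, (), y, rfl, hy, fun y' hy' => hL.fixed ▸ mem_operator.2 ⟨j, y', hy', rfl⟩⟩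
  exact (key hA hA').antisymm (key hA' hA)

/-- The points obtained from `E` by repeatedly applying the maps of the system; this is the least
set that contains `E` and is stable under the system. -/
inductive Generated (S : GIFS X m ι) (E : Set X) : X → Prop
  | base {x : X} (hx : x ∈ E) : Generated S E x
  | step (j : ι) (y : Fin m → X) (hy : ∀ i, Generated S E (y i)) : Generated S E (S.map j y)

theorem finite_operator (S : GIFS X m ι) {E : Set X} (hE : E.Finite) :
    (S.operator fun _ => E).Finite :=
  finite_iUnion fun _ => (Finite.pi' fun _ => hE).image _ |>.subset
    (image_mono fun _ hx i => hx i (mem_univ i))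

/-- Some finite set lies at bounded distance from everything that the system generates from it. -/
theorem exists_finite_near_generated [Nonempty X] [Nonempty ι] (S : GIFS X m ι) {φ : ℝ≥0 → ℝ≥0}
    (hφ : IsComparison φ) (hS : ∀ j x y, nndist (S.map j x) (S.map j y) ≤ φ (nndist x y)) :
    ∃ (E : Set X) (r : ℝ≥0), E.Finite ∧ E.Nonempty ∧
      ∀ x, S.Generated E x → ∃ e ∈ E, nndist x e ≤ r := by
  obtain ⟨x₀⟩ := ‹Nonempty X›
  obtain ⟨c, hc⟩ := (finite_range fun j => nndist (S.map j fun _ => x₀) x₀).bddAbove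
  let E : ℕ → Set X := fun k => (fun F : Set X => S.operator fun _ => F)^[k] {x₀}
  have hEs : ∀ k, E (k + 1) = S.operator fun _ => E k := fun k =>
    Function.iterate_succ_apply' _ _ _
  have hfin : ∀ k, (E k).Finite := by
    intro k
    induction k with
    | zero => exact finite_singleton x₀
    | succ k ih => rw [hEs]; exact S.finite_operator ih
  have hne : ∀ k, (E k).Nonempty := by
    intro k
    induction k with
    | zero => exact singleton_nonempty x₀
    | succ k ih =>
      obtain ⟨e, he⟩ := ih
      rw [hEs]
      exact ⟨_, mem_operator.2 ⟨Classical.arbitrary ι, fun _ => e, fun _ => he, rfl⟩⟩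
  have hmove : ∀ k, ∀ x ∈ E (k + 1), ∃ e ∈ E k, nndist x e ≤ φ^[k] c := by
    intro k
    induction k with
    | zero =>
      intro x hx
      rw [hEs, mem_operator] at hx
      obtain ⟨j, y, hy, rfl⟩ := hx
      obtain rfl : y = fun _ => x₀ := funext hy
      exact ⟨x₀, rfl, hc ⟨j, rfl⟩⟩
    | succ k ih =>
      intro x hx
      rw [hEs, mem_operator] at hx
      obtain ⟨j, y, hy, rfl⟩ := hx
      choose e he hd using fun i => ih (y i) (hy i)
      refine ⟨S.map j e, hEs k ▸ mem_operator.2 ⟨j, e, he, rfl⟩, ?_⟩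
      rw [Function.iterate_succ_apply']
      exact (hS j y e).trans (hφ.mono (nndist_pi_le_iff.2 hd))
  -- The maps bring `r`-close tuples to distance at most `1`, which leaves room `r - 1` for the
  -- distance from `E (k + 1)` back to `E k`.
  obtain ⟨r, hr, hφr⟩ := hφ.exists_gt 1 one_pos
  obtain ⟨k, hk⟩ := ((hφ.tendsto_iterate c).eventually_lt_const (tsub_pos_of_lt hr)).exists
  refine ⟨E k, r, hfin k, hne k, fun x hx => ?_⟩
  induction hx with
  | base hx => exact ⟨_, hx, by simp⟩
  | step j y _ ih =>
    choose e he hd using ih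
    obtain ⟨e', he', hd'⟩ := hmove k (S.map j e) (hEs k ▸ mem_operator.2 ⟨j, e, he, rfl⟩)
    refine ⟨e', he', (nndist_triangle _ (S.map j e) _).trans ?_⟩
    calc nndist (S.map j y) (S.map j e) + nndist (S.map j e) e'
        ≤ 1 + (r - 1) :=
          add_le_add (((hS j y e).trans (hφ.mono (nndist_pi_le_iff.2 hd))).trans hφr)
            (hd'.trans hk.le)
      _ = r := add_tsub_cancel_of_le hr.le

/-- The closure of the set generated by a suitable finite set is compact. -/
theorem exists_compact_invariant [CompleteSpace X] [Nonempty X] [Nonempty ι] (S : GIFS X m ι)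
    {φ : ℝ≥0 → ℝ≥0} (hφ : IsComparison φ)
    (hS : ∀ j x y, nndist (S.map j x) (S.map j y) ≤ φ (nndist x y)) :
    ∃ K : Set X, IsCompact K ∧ K.Nonempty ∧ ∀ j y, (∀ i, y i ∈ K) → S.map j y ∈ K := by
  obtain ⟨E, r, hE, hEne, hr⟩ := S.exists_finite_near_generated hφ hS
  -- If `F` is a finite `t`-net of the generated set, then `E ∪ S(F, …, F)` is a `φ t`-net.
  have hnet : ∀ k : ℕ, ∃ F : Set X, F.Finite ∧
      ∀ x, S.Generated E x → ∃ e ∈ F, nndist x e ≤ φ^[k] r := by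
    intro k
    induction k with
    | zero => exact ⟨E, hE, hr⟩
    | succ k ih =>
      obtain ⟨F, hF, hd⟩ := ih
      refine ⟨E ∪ S.operator fun _ => F, hE.union (S.finite_operator hF), fun x hx => ?_⟩
      cases hx with
      | base hx => exact ⟨x, .inl hx, by simp⟩
      | step j y hy =>
        choose e he hd using fun i => hd (y i) (hy i)
        refine ⟨S.map j e, .inr (mem_operator.2 ⟨j, e, he, rfl⟩), ?_⟩
        rw [Function.iterate_succ_apply']
        exact (hS j y e).trans (hφ.mono (nndist_pi_le_iff.2 hd))
  have htb : TotallyBounded {x | S.Generated E x} := by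
    rw [Metric.totallyBounded_iff]
    intro ε hε
    lift ε to ℝ≥0 using hε.le
    obtain ⟨k, hk⟩ := ((hφ.tendsto_iterate r).eventually_lt_const (NNReal.coe_pos.1 hε)).exists
    obtain ⟨F, hF, hd⟩ := hnet k
    refine ⟨F, hF, fun x hx => ?_⟩
    obtain ⟨e, he, hxe⟩ := hd x hx
    refine mem_iUnion₂.2 ⟨e, he, ?_⟩
    rw [Metric.mem_ball, ← coe_nndist]
    exact NNReal.coe_lt_coe.2 (hxe.trans_lt hk)
  refine ⟨closure {x | S.Generated E x}, htb.closure.isCompact_of_isClosed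
    isClosed_closure, (hEne.mono fun x hx => .base hx).closure, fun j y hy => ?_⟩
  have hy' : y ∈ closure (univ.pi fun _ : Fin m => {x | S.Generated E x}) := by
    rw [closure_pi_set]
    exact fun i _ => hy i
  exact map_mem_closure (S.continuous_map j) hy' fun z hz =>
    Generated.step j z fun i => hz i (mem_univ i)

/-- In a compact invariant set a point that is moved least by `x ↦ φ_j (x, …, x)` is fixed. -/
theorem exists_diagonal_fixedPoint (S : GIFS X m ι) {φ : ℝ≥0 → ℝ≥0} (hφ : IsComparison φ)
    (hS : ∀ j x y, nndist (S.map j x) (S.map j y) ≤ φ (nndist x y)) {K : Set X}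
    (hK : IsCompact K) (hne : K.Nonempty) (hinv : ∀ j y, (∀ i, y i ∈ K) → S.map j y ∈ K) (j : ι) :
    ∃ p ∈ K, S.map j (fun _ => p) = p := by
  have hcont : Continuous fun x => S.map j fun _ => x :=
    (S.continuous_map j).comp (continuous_pi fun _ => continuous_id)
  obtain ⟨p, hp, hmin⟩ := hK.exists_isMinOn hne
    (continuous_id.nndist hcont).continuousOn
  refine ⟨p, hp, ?_⟩
  by_contra hne
  have hpos : 0 < nndist p (S.map j fun _ => p) := by
    rw [pos_iff_ne_zero, Ne, nndist_eq_zero]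
    exact fun h => hne h.symm
  have h1 := hmin (hinv j _ fun _ => hp)
  have h2 : nndist (S.map j fun _ => p) (S.map j fun _ => S.map j fun _ => p) ≤
      φ (nndist p (S.map j fun _ => p)) :=
    (hS j _ _).trans (hφ.mono (nndist_pi_const_le _ _))
  exact absurd (h1.trans h2) (hφ.lt_self _ hpos).not_ge

end GIFS

/-! ### Grey level maps and suprema over fibres -/

namespace IsAdmissible

variable {ι : Type*} {ρ : ι → I → I}

/-- Right-continuity makes the superlevel sets of a grey level map closed half-lines. -/
theorem exists_le_iff (hρ : IsAdmissible ρ) (j : ι) {α t₀ : I} (h : α ≤ ρ j t₀) :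
    ∃ β, ∀ t, α ≤ ρ j t ↔ β ≤ t := by
  set T := {t | α ≤ ρ j t} with hT
  have hne : T.Nonempty := ⟨t₀, h⟩
  have hmem : α ≤ ρ j (sInf T) := by
    have hcl : sInf T ∈ closure T := csInf_mem_closure hne (OrderBot.bddBelow T)
    have hc : ContinuousWithinAt (ρ j) T (sInf T) :=
      (hρ.right_continuous j _).mono fun t ht => sInf_le ht
    have himg : ρ j '' T ⊆ Ici α := by
      rintro _ ⟨t, ht, rfl⟩
      exact ht
    exact isClosed_Ici.closure_subset_iff.2 himg (hc.mem_closure_image hcl)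
  exact ⟨sInf T, fun t => ⟨fun ht => sInf_le ht, fun ht => hmem.trans (hρ.monotone j ht)⟩⟩

theorem pos_of_map_pos (hρ : IsAdmissible ρ) {j : ι} {t : I} (h : 0 < ρ j t) : 0 < t := by
  rw [pos_iff_ne_zero]
  rintro rfl
  exact h.ne' (hρ.map_zero j)

end IsAdmissible

namespace IsProperSystem

variable {ι : Type*} {ρ : ι → I → I}

theorem map_pos (hρ : IsProperSystem ρ) (j : ι) {t : I} (ht : 0 < t) : 0 < ρ j t := by
  rw [← hρ.threshold_eq_zero j, greyThreshold, sInf_lt_iff] at ht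
  obtain ⟨s, hs, hst⟩ := ht
  exact lt_of_lt_of_le hs (hρ.admissible.monotone j hst.le)

theorem eq_one_of_map_eq_one (hρ : IsProperSystem ρ) {j : ι} {t : I} (ht : ρ j t = 1) :
    t = 1 := by
  have h1 : ρ j 1 = 1 := le_antisymm unitInterval.le_one'
    (ht.ge.trans (hρ.admissible.monotone j unitInterval.le_one'))
  have h := hρ.beta_eq_one j
  rw [h1] at h
  exact le_antisymm unitInterval.le_one' (h ▸ sInf_le ht.ge)

end IsProperSystem

namespace FuzzySet

variable {X : Type*} {m : ℕ}

theorem le_prod_iff {u : Fin m → FuzzySet X} {α : I} {x : Fin m → X} :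
    α ≤ prod u x ↔ ∀ i, α ≤ u i (x i) :=
  le_iInf_iff

theorem prod_pos {u : Fin m → FuzzySet X} {x : Fin m → X} (h : ∀ i, 0 < u i (x i)) :
    0 < prod u x := by
  rcases isEmpty_or_nonempty (Fin m) with hm | hm
  · exact zero_lt_one.trans_le (le_iInf fun i => hm.elim i)
  · obtain ⟨i, hi⟩ := exists_eq_ciInf_of_finite (f := fun i => u i (x i))
    exact (h i).trans_eq hi

theorem prod_support_subset {u : FuzzySet X} {K : Set X} (hsupp : {x | 0 < u x} ⊆ K) :
    {y | 0 < prod (fun _ : Fin m => u) y} ⊆ univ.pi fun _ => K :=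
  fun y hy i _ => hsupp (show 0 < u (y i) from lt_of_lt_of_le hy (iInf_le _ i))

theorem upperSemicontinuous_prod [TopologicalSpace X] {u : Fin m → FuzzySet X}
    (hu : ∀ i, UpperSemicontinuous (u i)) : UpperSemicontinuous (prod u) :=
  upperSemicontinuous_iInf fun i => (hu i).comp (continuous_apply i)

theorem support_subset_cut_zero [TopologicalSpace X] (u : FuzzySet X) : {x | 0 < u x} ⊆ u.cut 0 := by
  rw [cut_zero]
  exact subset_closure

theorem isClosed_superlevel [TopologicalSpace X] {u : FuzzySet X} (hu : UpperSemicontinuous u)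
    (α : I) : IsClosed {x | α ≤ u x} :=
  upperSemicontinuous_iff_isClosed_preimage.1 hu α

/-- A positive supremum over a fibre is attained. -/
theorem exists_eq_image [TopologicalSpace X] [T2Space X] {Y : Type*} [TopologicalSpace Y]
    [T1Space Y] {T : X → Y} (hT : Continuous T) {u : FuzzySet X} (hu : UpperSemicontinuous u)
    {K : Set X} (hK : IsCompact K) (hsupp : {x | 0 < u x} ⊆ K) {y : Y} (hy : 0 < image T u y) :
    ∃ x, T x = y ∧ u x = image T u y := by
  obtain ⟨_, ⟨x₁, hx₁, rfl⟩, h₁⟩ := lt_sSup_iff.1 hy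
  have hC : IsCompact (K ∩ T ⁻¹' {y}) := hK.inter_right (isClosed_singleton.preimage hT)
  obtain ⟨x, hx, hmax⟩ := (hu.upperSemicontinuousOn _).exists_isMaxOn
    (show (K ∩ T ⁻¹' {y}).Nonempty from ⟨x₁, hsupp h₁, hx₁⟩) hC
  refine ⟨x, hx.2, le_antisymm (le_sSup ⟨x, hx.2, rfl⟩) (sSup_le ?_)⟩
  rintro _ ⟨x', hx', rfl⟩
  by_cases h : 0 < u x'
  · exact hmax ⟨hsupp h, hx'⟩
  · exact (not_lt.1 h).trans unitInterval.nonneg'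

end FuzzySet

/-! ### The fuzzy operator -/

namespace GIFZS

variable {X : Type*} [MetricSpace X] {m : ℕ} {ι : Type*} [Finite ι] (Z : GIFZS X m ι)

theorem le_operator {u : FuzzySet X} {j : ι} {y : Fin m → X} {α : I}
    (h : α ≤ Z.grey j (FuzzySet.prod (fun _ => u) y)) :
    α ≤ Z.operator (fun _ => u) (Z.map j y) := by
  refine h.trans (le_trans ?_ (le_iSup
    (fun j' => Z.grey j' (FuzzySet.image (Z.map j') (FuzzySet.prod fun _ => u) (Z.map j y))) j))
  exact Z.admissible.monotone j (le_sSup ⟨y, rfl, rfl⟩)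

/-- The positive superlevel sets of `Z(u)`: all suprema in its definition are attained. -/
theorem le_operator_iff {u : FuzzySet X} (hu : UpperSemicontinuous u) {K : Set X}
    (hK : IsCompact K) (hsupp : {x | 0 < u x} ⊆ K) {α : I} (hα : 0 < α) {z : X} :
    α ≤ Z.operator (fun _ => u) z ↔
      ∃ j y, Z.map j y = z ∧ α ≤ Z.grey j (FuzzySet.prod (fun _ => u) y) := by
  refine ⟨fun h => ?_, ?_⟩
  · have : Nonempty ι := ⟨Z.admissible.exists_map_one.choose⟩
    obtain ⟨j, hj⟩ := exists_eq_ciSup_of_finite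
      (f := fun j => Z.grey j (FuzzySet.image (Z.map j) (FuzzySet.prod fun _ => u) z))
    have hα' : α ≤ Z.grey j (FuzzySet.image (Z.map j) (FuzzySet.prod fun _ => u) z) :=
      h.trans hj.ge
    obtain ⟨y, hy, hval⟩ := FuzzySet.exists_eq_image (Z.continuous_map j)
      (FuzzySet.upperSemicontinuous_prod fun _ => hu) (isCompact_univ_pi fun _ => hK)
      (FuzzySet.prod_support_subset hsupp) (Z.admissible.pos_of_map_pos (hα.trans_le hα'))
    exact ⟨j, y, hy, hval ▸ hα'⟩
  · rintro ⟨j, y, rfl, h⟩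
    exact Z.le_operator h

theorem operator_mono {u v : FuzzySet X} (h : u ≤ v) :
    Z.operator (fun _ => u) ≤ Z.operator (fun _ => v) := by
  refine fun z => iSup_mono fun j => Z.admissible.monotone j (sSup_le ?_)
  rintro _ ⟨y, hy, rfl⟩
  exact (iInf_mono fun i => h (y i)).trans (le_sSup (mem_image_of_mem _ hy))

/-- The superlevel sets of `Z(u)` are finite unions of continuous images of superlevel sets of the
product fuzzy set, which are compact. -/
theorem upperSemicontinuous_operator {u : FuzzySet X} (hu : UpperSemicontinuous u) {K : Set X}
    (hK : IsCompact K) (hsupp : {x | 0 < u x} ⊆ K) :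
    UpperSemicontinuous (Z.operator fun _ => u) := by
  rw [upperSemicontinuous_iff_isClosed_preimage]
  intro α
  rcases eq_zero_or_pos α with rfl | hα
  · convert isClosed_univ
    exact eq_univ_of_forall fun _ => unitInterval.nonneg'
  have heq : Z.operator (fun _ => u) ⁻¹' Ici α =
      ⋃ j, Z.map j '' {y | α ≤ Z.grey j (FuzzySet.prod (fun _ => u) y)} := by
    ext z
    simp only [mem_preimage, mem_Ici, Z.le_operator_iff hu hK hsupp hα, mem_iUnion, mem_image,
      mem_ofPred_eq]
    exact exists_congr fun j => exists_congr fun y => and_comm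
  rw [heq]
  refine isClosed_iUnion_of_finite fun j => (IsCompact.image ?_ (Z.continuous_map j)).isClosed
  have hsub : {y | α ≤ Z.grey j (FuzzySet.prod (fun _ : Fin m => u) y)} ⊆ univ.pi fun _ => K :=
    fun y hy => FuzzySet.prod_support_subset hsupp (Z.admissible.pos_of_map_pos (hα.trans_le hy))
  refine (isCompact_univ_pi fun _ => hK).of_isClosed_subset ?_ hsub
  by_cases hne : ∃ t, α ≤ Z.grey j t
  · obtain ⟨t, ht⟩ := hne
    obtain ⟨β, hβ⟩ := Z.admissible.exists_le_iff j ht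
    simp only [hβ]
    exact FuzzySet.isClosed_superlevel (FuzzySet.upperSemicontinuous_prod fun _ => hu) β
  · convert isClosed_empty
    exact eq_empty_of_forall_notMem fun y hy => hne ⟨_, hy⟩

/-! ### Existence and uniqueness of the fuzzy attractor -/

theorem exists_isFuzzyAttractor [CompleteSpace X] [Nonempty X]
    {φ : ℝ≥0 → ℝ≥0} (hφ : IsComparison φ)
    (hS : ∀ j x y, nndist (Z.map j x) (Z.map j y) ≤ φ (nndist x y)) :
    ∃ u : FuzzySet X, Z.IsFuzzyAttractor u := by
  classical
  obtain ⟨j₀, hj₀⟩ := Z.admissible.exists_map_one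
  have : Nonempty ι := ⟨j₀⟩
  obtain ⟨K, hK, hKne, hinv⟩ := Z.toGIFS.exists_compact_invariant hφ hS
  obtain ⟨p, hp, hfix⟩ := Z.toGIFS.exists_diagonal_fixedPoint hφ hS hK hKne hinv j₀
  -- `V` is closed under infima and under `Z`, so its least element is fixed by `Z`.
  let V : Set (FuzzySet X) := {v | UpperSemicontinuous v ∧ {x | 0 < v x} ⊆ K ∧ v p = 1 ∧
    Z.operator (fun _ => v) ≤ v}
  have hV : ∀ v ∈ V, Z.operator (fun _ => v) ∈ V := by
    rintro v ⟨husc, hsupp, h1, hle⟩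
    refine ⟨Z.upperSemicontinuous_operator husc hK hsupp, fun x hx => hsupp (hx.trans_le (hle x)),
      le_antisymm unitInterval.le_one' ?_, Z.operator_mono hle⟩
    have h : (1 : I) ≤ Z.grey j₀ (FuzzySet.prod (fun _ : Fin m => v) fun _ => p) := by
      have : FuzzySet.prod (fun _ : Fin m => v) (fun _ => p) = 1 :=
        le_antisymm unitInterval.le_one' (FuzzySet.le_prod_iff.2 fun _ => h1.ge)
      rw [this, hj₀]
    have := Z.le_operator h
    rwa [hfix] at this
  have hind : (fun x => if x ∈ K then 1 else 0 : FuzzySet X) ∈ V := by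
    have hsupp : {x | 0 < (if x ∈ K then 1 else 0 : I)} ⊆ K := fun x hx => by
      by_contra h
      simp [h] at hx
    have husc : UpperSemicontinuous (fun x => if x ∈ K then 1 else 0 : FuzzySet X) := by
      rw [upperSemicontinuous_iff_isClosed_preimage]
      intro α
      rcases eq_zero_or_pos α with rfl | hα
      · convert isClosed_univ
        exact eq_univ_of_forall fun _ => unitInterval.nonneg'
      · convert hK.isClosed
        ext x
        by_cases hx : x ∈ K
        · simp [hx, unitInterval.le_one']
        · simpa [hx] using hα.ne'
    refine ⟨husc, hsupp, if_pos hp, fun z => ?_⟩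
    by_cases hz : z ∈ K
    · simpa [hz] using unitInterval.le_one'
    · by_contra! hlt
      have hpos : 0 < Z.operator (fun _ => fun x => if x ∈ K then 1 else 0) z :=
        lt_of_le_of_lt unitInterval.nonneg' hlt
      obtain ⟨j, y, rfl, hy⟩ := (Z.le_operator_iff husc hK hsupp hpos).1 le_rfl
      have := FuzzySet.prod_support_subset hsupp (Z.admissible.pos_of_map_pos (hpos.trans_le hy))
      exact hz (hinv j y fun i => this i (mem_univ i))
  have hinf : sInf V ∈ V := by
    refine ⟨?_, ?_, ?_, ?_⟩
    · have : UpperSemicontinuous fun x => ⨅ v : V, (v : FuzzySet X) x :=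
        upperSemicontinuous_iInf fun v => v.2.1
      convert this
      exact sInf_apply
    · exact fun x hx => hind.2.1 (hx.trans_le (sInf_le hind x))
    · rw [sInf_apply]
      exact le_antisymm unitInterval.le_one' (le_iInf fun v => v.2.2.2.1.ge)
    · exact le_sInf fun v hv => (Z.operator_mono (sInf_le hv)).trans hv.2.2.2
  refine ⟨sInf V, ⟨⟨p, hinf.2.2.1⟩, hinf.1, ?_⟩, hinf.2.2.2.antisymm (sInf_le (hV _ hinf))⟩
  rw [FuzzySet.cut_zero]
  exact hK.closure_of_subset hinf.2.1

variable {Z}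

theorem IsFuzzyAttractor.le_iff {u : FuzzySet X} (hu : Z.IsFuzzyAttractor u) {α : I} (hα : 0 < α)
    {z : X} : α ≤ u z ↔ ∃ j y, Z.map j y = z ∧ α ≤ Z.grey j (FuzzySet.prod (fun _ => u) y) := by
  rw [← Z.le_operator_iff hu.star.usc hu.star.compact_support (u.support_subset_cut_zero) hα,
    hu.fixed]

theorem IsFuzzyAttractor.unique {φ : ℝ≥0 → ℝ≥0} (hφ : IsComparison φ)
    (hS : ∀ j x y, nndist (Z.map j x) (Z.map j y) ≤ φ (nndist x y)) {u v : FuzzySet X}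
    (hu : Z.IsFuzzyAttractor u) (hv : Z.IsFuzzyAttractor v) : u = v := by
  have key : ∀ {u v : FuzzySet X}, Z.IsFuzzyAttractor u → Z.IsFuzzyAttractor v → u ≤ v := by
    intro u v hu hv x
    rcases eq_zero_or_pos (u x) with h0 | hpos
    · rw [h0]
      exact unitInterval.nonneg'
    obtain ⟨p, hp⟩ := hv.star.normal
    obtain ⟨B, hB⟩ := hu.star.compact_support.isBounded.subset_closedBall p
    refine Z.toGIFS.subset_of_selfSimilar hφ hS (T := {α : I // 0 < α})
      (K := fun α => {x | α.1 ≤ u x}) (L := fun α => {x | α.1 ≤ v x})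
      (fun α => FuzzySet.isClosed_superlevel hv.star.usc α.1) (B := B.toNNReal)
      (fun α x hx => ⟨p, ?_, ?_⟩) (fun α x hx => ?_) ⟨u x, hpos⟩ (le_refl (u x))
    · exact unitInterval.le_one'.trans hp.ge
    · rw [← NNReal.coe_le_coe, coe_nndist]
      exact (hB (u.support_subset_cut_zero (α.2.trans_le hx))).trans (Real.le_coe_toNNReal B)
    · obtain ⟨j, y, rfl, hy⟩ := (hu.le_iff α.2).1 hx
      -- The relevant level of the arguments is `min u(y_i)`, positive since `ρ_j 0 = 0`.
      refine ⟨j, ⟨_, Z.admissible.pos_of_map_pos (α.2.trans_le hy)⟩, y, rfl,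
        FuzzySet.le_prod_iff.1 le_rfl, fun y' hy' => ?_⟩
      exact (hv.le_iff α.2).2 ⟨j, y', rfl,
        hy.trans (Z.admissible.monotone j (FuzzySet.le_prod_iff.2 hy'))⟩
  exact (key hu hv).antisymm (key hv hu)

/-! ### The cuts of the fuzzy attractor -/

theorem IsFuzzyAttractor.pos_iff (hρ : IsProperSystem Z.grey) {u : FuzzySet X}
    (hu : Z.IsFuzzyAttractor u) {z : X} :
    0 < u z ↔ ∃ j y, (∀ i, 0 < u (y i)) ∧ Z.map j y = z := by
  constructor
  · intro h
    obtain ⟨j, y, hy, hle⟩ := (hu.le_iff h).1 le_rfl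
    have hpos := Z.admissible.pos_of_map_pos (h.trans_le hle)
    exact ⟨j, y, fun i => hpos.trans_le (iInf_le _ i), hy⟩
  · rintro ⟨j, y, hy, rfl⟩
    have hpos := hρ.map_pos j (FuzzySet.prod_pos (u := fun _ => u) hy)
    exact hpos.trans_le ((hu.le_iff hpos).2 ⟨j, y, rfl, le_rfl⟩)

theorem IsFuzzyAttractor.isAttractor_cut_zero (hρ : IsProperSystem Z.grey) {u : FuzzySet X}
    (hu : Z.IsFuzzyAttractor u) : Z.toGIFS.IsAttractor (u.cut 0) where
  nonempty := by
    obtain ⟨p, hp⟩ := hu.star.normal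
    exact ⟨p, u.support_subset_cut_zero (hp ▸ zero_lt_one : 0 < u p)⟩
  compact := hu.star.compact_support
  fixed := by
    apply Subset.antisymm
    · intro x hx
      obtain ⟨j, y, hy, rfl⟩ := GIFS.mem_operator.1 hx
      have hy' : y ∈ closure (univ.pi fun _ : Fin m => {x | 0 < u x}) := by
        rw [closure_pi_set]
        exact fun i _ => FuzzySet.cut_zero u ▸ hy i
      rw [FuzzySet.cut_zero]
      exact map_mem_closure (Z.continuous_map j) hy' fun z hz =>
        (hu.pos_iff hρ).2 ⟨j, z, fun i => hz i (mem_univ i), rfl⟩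
    · have hcl : IsClosed (Z.toGIFS.operator fun _ => u.cut 0) :=
        isClosed_iUnion_of_finite fun j =>
          ((isCompact_univ_pi fun _ => hu.star.compact_support).image
            (Z.continuous_map j)).isClosed
      conv_lhs => rw [FuzzySet.cut_zero]
      refine hcl.closure_subset_iff.2 fun x hx => ?_
      obtain ⟨j, y, hy, rfl⟩ := (hu.pos_iff hρ).1 hx
      exact GIFS.mem_operator.2 ⟨j, y, fun i => u.support_subset_cut_zero (hy i), rfl⟩

theorem IsFuzzyAttractor.isAttractor_cut_one (hρ : IsProperSystem Z.grey) {u : FuzzySet X}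
    (hu : Z.IsFuzzyAttractor u) :
    (Z.toGIFS.restrict {j | Z.grey j 1 = 1}).IsAttractor (u.cut 1) := by
  have hcut : u.cut 1 = {x | 1 ≤ u x} := FuzzySet.cut_of_pos u zero_lt_one
  rw [hcut]
  refine ⟨?_, ?_, ?_⟩
  · obtain ⟨p, hp⟩ := hu.star.normal
    exact ⟨p, hp.ge⟩
  · exact hu.star.compact_support.of_isClosed_subset
      (FuzzySet.isClosed_superlevel hu.star.usc 1)
      fun x hx => u.support_subset_cut_zero (show 0 < u x from zero_lt_one.trans_le hx)
  · ext x
    rw [GIFS.mem_operator, mem_ofPred_eq, hu.le_iff zero_lt_one]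
    constructor
    · rintro ⟨⟨j, hj⟩, y, hy, rfl⟩
      have h1 : FuzzySet.prod (fun _ => u) y = 1 :=
        le_antisymm unitInterval.le_one' (FuzzySet.le_prod_iff.2 hy)
      exact ⟨j, y, rfl, by rw [h1]; exact hj.ge⟩
    · rintro ⟨j, y, rfl, hle⟩
      have hone := le_antisymm unitInterval.le_one' hle
      have h1 := hρ.eq_one_of_map_eq_one hone
      rw [h1] at hone
      exact ⟨⟨j, hone⟩, y, FuzzySet.le_prod_iff.1 h1.ge, rfl⟩

end GIFZS

theorem corollaryf3 {X : Type*} [MetricSpace X] [CompleteSpace X] [Nonempty X]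
    {m n : ℕ} (hm : 1 ≤ m) (Z : GIFZS X m (Fin n))
    (hZ : Z.toGIFS.IsMatkowskiContractive) (hρ : IsProperSystem Z.grey) :
    (∃! u : FuzzySet X, Z.IsFuzzyAttractor u) ∧
    (∃! A : Set X, Z.toGIFS.IsAttractor A) ∧
    (∃! A' : Set X, (Z.toGIFS.restrict {j | Z.grey j 1 = 1}).IsAttractor A') ∧
    ∀ (u : FuzzySet X) (A A' : Set X), Z.IsFuzzyAttractor u → Z.toGIFS.IsAttractor A →
      (Z.toGIFS.restrict {j | Z.grey j 1 = 1}).IsAttractor A' →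
      u.cut 0 = A ∧ u.cut 1 = A' := by
  obtain ⟨φ, hφ, hS⟩ := hZ.exists_isComparison
  have hS' : ∀ j x y, nndist ((Z.toGIFS.restrict {j | Z.grey j 1 = 1}).map j x)
      ((Z.toGIFS.restrict {j | Z.grey j 1 = 1}).map j y) ≤ φ (nndist x y) :=
    fun j => hS j.1
  obtain ⟨u, hu⟩ := Z.exists_isFuzzyAttractor hφ hS
  refine ⟨⟨u, hu, fun v hv => hv.unique hφ hS hu⟩,
    ⟨u.cut 0, hu.isAttractor_cut_zero hρ,
      fun A hA => hA.unique hφ hS (hu.isAttractor_cut_zero hρ)⟩,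
    ⟨u.cut 1, hu.isAttractor_cut_one hρ,
      fun A' hA' => hA'.unique hφ hS' (hu.isAttractor_cut_one hρ)⟩,
    fun v A A' hv hA hA' => ?_⟩
  exact ⟨(hv.isAttractor_cut_zero hρ).unique hφ hS hA,
    (hv.isAttractor_cut_one hρ).unique hφ hS' hA'⟩
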